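/- Let $(R,\mathfrak m)$ be a Cohen–Macaulay (Noetherian) local ring of dimension one with total quotient ring $\mathrm{Q}(R)$, let $\overline R$ be the integral closure of $R$ in $\mathrm{Q}(R)$, and let $I$ be a regular ideal of $R$, that is, an ideal containing a non-zerodivisor. For an ideal $J$ put $R:J=\{\alpha\in \mathrm{Q}(R)\mid \alpha J\subseteq R\}$. For an $R$-module $M$ let $\operatorname{tr}_R(M)=\sum_{f\in\operatorname{Hom}_R(M,R)}\operatorname{Im} f$ and $h(M)=\inf\{\ell_R(R/\operatorname{Im} f)\mid f\in\operatorname{Hom}_R(M,R)\}$; an ideal $J$ is a partial trace ideal of $M$ if $J=\operatorname{Im} f$ for some $f\in\operatorname{Hom}_R(M,R)$ and $\ell_R(R/J)=h(M)$, and it is a partial trace ideal if it is one of some finitely generated $R$-module. An ideal $J\subseteq L$ is a reduction of $L$ if $L^{n+1}=JL^n$ for some $n>0$. Consider the conditions 1. $I$ is a partial trace ideal; 2. $I$ is a partial trace ideal of $I$; 3. $R:I\subseteq\overline R$; 4. $I$ is a reduction of $\operatorname{tr}_R(I)$. (a) Conditions (1) and (2) are equivalent, and (3) implies (1), (2) and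 (4). (b) If every $\mathfrak m$-primary ideal of $R$ has a principal reduction, then (1), (2), (3) and (4) are equivalent. (c) Suppose that $\overline R$ is a discrete valuation ring with maximal ideal $\mathfrak n$ and that $R/\mathfrak m\cong\overline R/\mathfrak n$. Let $v:\mathrm{Q}(R)\to\mathbb Z\cup\{\infty\}$ be the normalized valuation, $v(a/b)=\ell_{\overline R}(\overline R/a\overline R)-\ell_{\overline R}(\overline R/b\overline R)$ for $a,b\in R$ with $b$ a non-zerodivisor. If $J$ is a partial trace ideal of $I$, then $$\{\text{partial trace ideals of } I\}=\{\alpha J\mid \alpha\in R:J,\ v(\alpha)=0\}.$$ -/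

import Mathlib

universe u v

namespace PartialTrace

section General

variable (R : Type*) [CommRing R]

/-- A Noetherian local ring is Cohen–Macaulay if it has a regular sequence whose length is the
Krull dimension. (`RingTheory.Sequence.IsRegular` contains `R ≠ (rs)`, so the sequence lies in the
maximal ideal.) -/
structure IsCohenMacaulayLocalRing [IsLocalRing R] : Prop where
  isNoetherianRing : IsNoetherianRing R
  exists_isRegular : ∃ rs : List R,
    RingTheory.Sequence.IsRegular R rs ∧ ((rs.length : ℕ∞) : WithBot ℕ∞) = ringKrullDim R

variable {R}

/-- A regular ideal: it contains a non-zerodivisor. -/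
def IsRegularIdeal (I : Ideal R) : Prop := ∃ x ∈ I, x ∈ nonZeroDivisors R

/-- `J` is a reduction of `I`: `J ⊆ I` and `I ^ (n + 1) = J * I ^ n` for some `n > 0`. -/
def IsReduction (J I : Ideal R) : Prop := J ≤ I ∧ ∃ n : ℕ, 0 < n ∧ I ^ (n + 1) = J * I ^ n

/-- `I` has a principal reduction. -/
def HasPrincipalReduction (I : Ideal R) : Prop := ∃ a : R, IsReduction (Ideal.span {a}) I

/-- `I` is primary to the maximal ideal. -/
def IsMaximalPrimary [IsLocalRing R] (I : Ideal R) : Prop :=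
  I.IsPrimary ∧ I.radical = IsLocalRing.maximalIdeal R

end General

section Trace

variable (R : Type*) [CommRing R] (M : Type*) [AddCommGroup M] [Module R M]

/-- The trace ideal of `M`: the sum of the images of all `R`-linear maps `M → R`. -/
def traceIdeal : Ideal R := ⨆ f : M →ₗ[R] R, LinearMap.range f

/-- The invariant `h(M)`, the least length of `R ⧸ Im f` over all `R`-linear `f : M → R`. -/
noncomputable def hInvariant : ℕ∞ := ⨅ f : M →ₗ[R] R, Module.length R (R ⧸ LinearMap.range f)

variable {R}

/-- `J` is a partial trace ideal of the module `M`. -/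
def IsPartialTraceIdealOf (J : Ideal R) : Prop :=
  ∃ f : M →ₗ[R] R, J = LinearMap.range f ∧ Module.length R (R ⧸ J) = hInvariant R M

end Trace

/-- `J` is a partial trace ideal, i.e. a partial trace ideal of some finitely generated module. -/
def IsPartialTraceIdeal {R : Type u} [CommRing R] (J : Ideal R) : Prop :=
  ∃ (M : Type u) (_ : AddCommGroup M) (_ : Module R M),
    Module.Finite R M ∧ IsPartialTraceIdealOf M J

section Fractional

variable {R : Type*} [CommRing R] (K : Type*) [CommRing K] [Algebra R K]

/-- The colon `R : I = {α ∈ K | α I ⊆ R}`, where `K` is the total quotient ring of `R`. -/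
noncomputable def colonRing (I : Ideal R) : Submodule R K :=
  1 / IsLocalization.coeSubmodule K I

variable {K}

/-- The `R`-submodule `α J = {α x | x ∈ J}` of `K`. -/
def scale (α : K) (J : Ideal R) : Submodule R K :=
  (IsLocalization.coeSubmodule K J).map (LinearMap.mulLeft R α)

variable (R)

/-- With `S` the integral closure of `R` in its total quotient ring `K`, the normalized valuation
`v(a / b) = ℓ_S(S / aS) - ℓ_S(S / bS) ∈ ℤ ∪ {∞}` for `a, b ∈ R` with `b` a non-zerodivisor.
(`Ring.ord S x` is the length of `S / xS`. If `S` is a discrete valuation ring, the value does not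
depend on the chosen fraction, see `normalizedVal_eq`.) -/
noncomputable def normalizedVal [IsFractionRing R K] (α : K) : WithTop ℤ :=
  let p : R × nonZeroDivisors R := IsLocalization.sec (nonZeroDivisors R) α
  ENat.map (Nat.cast : ℕ → ℤ)
      (Ring.ord (integralClosure R K) (algebraMap R (integralClosure R K) p.1)) -
    ENat.map (Nat.cast : ℕ → ℤ)
      (Ring.ord (integralClosure R K) (algebraMap R (integralClosure R K) p.2))

variable {R}

theorem normalizedVal_eq [IsFractionRing R K] [IsDomain (integralClosure R K)]
    [IsDiscreteValuationRing (integralClosure R K)] (α : K) (a : R) (b : nonZeroDivisors R)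
    (h : α * algebraMap R K b = algebraMap R K a) :
    normalizedVal R α =
      ENat.map (Nat.cast : ℕ → ℤ)
          (Ring.ord (integralClosure R K) (algebraMap R (integralClosure R K) a)) -
        ENat.map (Nat.cast : ℕ → ℤ)
          (Ring.ord (integralClosure R K) (algebraMap R (integralClosure R K) b)) := by
  have hinj : Function.Injective (algebraMap R K) := IsFractionRing.injective R K
  have hinj' : Function.Injective (algebraMap R (integralClosure R K)) := by
    intro x y hxy
    apply hinj
    simpa using congrArg (algebraMap (integralClosure R K) K) hxy
  have : Nontrivial R := by
    by_contra hR
    rw [not_nontrivial_iff_subsingleton] at hR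
    have h01 : (0 : integralClosure R K) = 1 := by
      rw [← map_zero (algebraMap R _), ← map_one (algebraMap R _), Subsingleton.elim (0 : R) 1]
    exact zero_ne_one h01
  have hnz : ∀ c : nonZeroDivisors R,
      algebraMap R (integralClosure R K) c ∈ nonZeroDivisors (integralClosure R K) := by
    intro c
    apply mem_nonZeroDivisors_of_ne_zero
    intro hc
    exact nonZeroDivisors.coe_ne_zero c (hinj' (by rw [hc, map_zero]))
  have key := IsLocalization.sec_spec (nonZeroDivisors R) α
  unfold normalizedVal
  generalize IsLocalization.sec (nonZeroDivisors R) α = p at key ⊢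
  obtain ⟨r, s⟩ := p
  simp only at key ⊢
  have hrs : a * (s : R) = r * (b : R) := by
    apply hinj
    rw [map_mul, map_mul, ← h, ← key]
    ring
  have hord := congrArg (fun z => Ring.ord (integralClosure R K)
    (algebraMap R (integralClosure R K) z)) hrs
  simp only [map_mul] at hord
  rw [Ring.ord_mul _ (hnz s), Ring.ord_mul _ (hnz b)] at hord
  have hs := Ring.ord_ne_top (hnz s)
  have hb := Ring.ord_ne_top (hnz b)
  revert hord hs hb
  generalize Ring.ord (integralClosure R K) (algebraMap R (integralClosure R K) a) = A
  generalize Ring.ord (integralClosure R K) (algebraMap R (integralClosure R K) b) = B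
  generalize Ring.ord (integralClosure R K) (algebraMap R (integralClosure R K) r) = C
  generalize Ring.ord (integralClosure R K) (algebraMap R (integralClosure R K) s) = D
  intro hord hs hb
  lift D to ℕ using hs
  lift B to ℕ using hb
  induction A using ENat.recTopCoe with
  | top =>
    induction C using ENat.recTopCoe with
    | top => simp only [ENat.map_top, ENat.map_natCast]; rfl
    | coe c =>
      exfalso
      rw [top_add] at hord
      exact ENat.natCast_ne_top (c + B) (by rw [hord]; push_cast; rfl)
  | coe a =>
    induction C using ENat.recTopCoe with
    | top =>
      exfalso
      rw [top_add] at hord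
      exact ENat.natCast_ne_top (a + D) (by rw [← hord]; push_cast; rfl)
    | coe c =>
      have h2 : a + D = c + B := by exact_mod_cast hord
      simp only [ENat.map_natCast]
      rw [← WithTop.LinearOrderedAddCommGroup.coe_sub,
        ← WithTop.LinearOrderedAddCommGroup.coe_sub]
      congr 1
      omega

end Fractional

end PartialTrace

/-!
Every `R`-linear map `I → R` from a regular ideal is multiplication by an element of the colon
`C = R : I`, so the partial trace ideals of `I` are the ideals `α I`, `α ∈ C`, of minimal colength,
and the trace ideal is `C I`.

Everything about lengths rests on one comparison, `length_le_of_coeSubmodule_eq_scale`: if `β` is a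
unit of `K`, integral over `R`, and `L = β J` with `J` a regular ideal, then
`ℓ(R/J) ≤ ℓ(R/L)`, and equality forces `β⁻¹` to be integral. Indeed, as `R[β]` has a common
denominator, `J` contains a regular ideal `D` with `β D ⊆ D`; since `J/D ≅ L/βD`, the difference of
the two lengths is `ℓ(D/βD)`.

* If `C` is integral over `R`, the comparison shows that no `α I` has smaller colength than `I`.
  The powers of `C ∋ 1` form an increasing chain in a finite `R`-algebra, so they stabilise, and
  `tr(I) ^ (n + 1) = C ^ (n + 1) I ^ (n + 1) = C ^ n I ^ (n + 1) = I tr(I) ^ n`.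
* Conversely, if `tr(I) ^ (n + 1) = I tr(I) ^ n`, then `C` stabilises the faithful finitely
  generated module `I tr(I) ^ n`, so `C` is integral.
* If `I` has minimal colength, let `x ∈ 𝔪 I` be a non-zerodivisor. A principal reduction of the
  `𝔪`-primary ideal `x C` is generated by some `x α` with `α ∈ C` and `C ^ (n + 1) = α C ^ n`.
  Hence `α` is a unit and `α⁻¹` is integral. The comparison for `I = α⁻¹ (α I)` and the minimality
  of `I` show that `α` is integral as well. So `C` stabilises the finitely generated module
  `R[α] C ^ n ∋ 1`, and `C` is integral.
* If the integral closure is a discrete valuation ring, then `v(α) = 0` means that `α` and `α⁻¹` are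
  both integral, and one of them always is. By the comparison, `α J` and `J` have the same colength
  if and only if `v(α) = 0`.
-/

namespace PartialTrace

open IsLocalization

/-! ### Colengths of regular ideals -/

section Lengths

variable {R : Type*} [CommRing R]

theorem exists_mem_nonZeroDivisors_mem_maximalIdeal [IsLocalRing R]
    (hCM : IsCohenMacaulayLocalRing R) (hdim : ringKrullDim R = 1) :
    ∃ t ∈ IsLocalRing.maximalIdeal R, t ∈ nonZeroDivisors R := by
  obtain ⟨rs, hreg, hlen⟩ := hCM.exists_isRegular
  rw [hdim] at hlen
  have hlen' : rs.length = 1 := by exact_mod_cast hlen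
  obtain ⟨t, rfl⟩ := List.length_eq_one_iff.mp hlen'
  refine ⟨t, ?_, ?_⟩
  · rw [IsLocalRing.mem_maximalIdeal, mem_nonunits_iff]
    intro ht
    apply hreg.top_ne_smul
    rw [Ideal.ofList_singleton, Ideal.span_singleton_eq_top.mpr ht, Submodule.top_smul]
  · have h := hreg.toIsWeaklyRegular
    rw [RingTheory.Sequence.isWeaklyRegular_singleton_iff] at h
    refine mem_nonZeroDivisors_iff_right.mpr fun x hx => ?_
    exact h.right_eq_zero_of_smul (by rwa [smul_eq_mul, mul_comm])

/-- Additivity of length along `0 → J/D → R/D → R/J → 0`. -/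
theorem length_quotient_eq_add {D J : Ideal R} (h : D ≤ J) :
    Module.length R (R ⧸ D) =
      Module.length R (J ⧸ D.submoduleOf J) + Module.length R (R ⧸ J) := by
  refine Module.length_eq_add_of_exact
    (Submodule.mapQ (D.submoduleOf J) D J.subtype le_rfl) (Submodule.factor h) ?_
    (Submodule.factor_surjective h) ?_
  · rw [← LinearMap.ker_eq_bot]
    exact Submodule.ker_liftQ_eq_bot' _ _ (by simp [LinearMap.ker_comp, Submodule.submoduleOf])
  · intro x
    obtain ⟨x, rfl⟩ := Submodule.Quotient.mk_surjective _ x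
    constructor
    · intro hx
      exact ⟨Submodule.Quotient.mk ⟨x, (Submodule.Quotient.mk_eq_zero J).mp hx⟩, rfl⟩
    · rintro ⟨y, hy⟩
      obtain ⟨y, rfl⟩ := Submodule.Quotient.mk_surjective _ y
      rw [← hy]
      exact (Submodule.Quotient.mk_eq_zero J).mpr y.2

theorem eq_of_length_quotient_le {D J : Ideal R} (h : D ≤ J)
    (hJ : Module.length R (R ⧸ J) ≠ ⊤)
    (hle : Module.length R (R ⧸ D) ≤ Module.length R (R ⧸ J)) : D = J := by
  rw [length_quotient_eq_add h] at hle
  have h0 : Module.length R (J ⧸ D.submoduleOf J) = 0 := by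
    by_contra h0
    have := (ENat.lt_add_left hJ (pos_iff_ne_zero.mpr h0))
    exact absurd hle (not_le.mpr this)
  rw [Module.length_eq_zero_iff, Submodule.Quotient.subsingleton_iff,
    Submodule.submoduleOf, Submodule.comap_subtype_eq_top] at h0
  exact le_antisymm h h0

theorem length_quotient_ne_top [IsNoetherianRing R] [Ring.KrullDimLE 1 R] {J : Ideal R}
    (hJ : IsRegularIdeal J) : Module.length R (R ⧸ J) ≠ ⊤ := by
  obtain ⟨x, hxJ, hx⟩ := hJ
  have h := length_quotient_eq_add ((Ideal.span_singleton_le_iff_mem (I := J)).mpr hxJ)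
  intro htop
  rw [htop, add_top] at h
  exact Ring.ord_ne_top hx h

/-- In the Artinian module `R/L` the chain `t ^ n (R/L)` stabilises, and `1 - t y` is a unit for
every `y`; so a power of `t` lies in `L`. -/
theorem isRegularIdeal_of_length_quotient_ne_top [IsLocalRing R] {t : R}
    (ht : t ∈ IsLocalRing.maximalIdeal R) (ht' : t ∈ nonZeroDivisors R) {L : Ideal R}
    (hL : Module.length R (R ⧸ L) ≠ ⊤) : IsRegularIdeal L := by
  rw [Module.length_ne_top_iff, isFiniteLength_iff_isNoetherian_isArtinian] at hL
  obtain ⟨-, hart⟩ := hL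
  obtain ⟨n, y, hy⟩ := IsArtinian.exists_pow_succ_smul_dvd t (Ideal.Quotient.mk L 1)
  obtain ⟨y, rfl⟩ := Ideal.Quotient.mk_surjective y
  refine ⟨t ^ n, ?_, pow_mem ht' n⟩
  have hu : IsUnit (1 - t * y) := by
    by_contra hu
    have h1 := Ideal.add_mem _ ((IsLocalRing.mem_maximalIdeal _).mpr hu)
      (Ideal.mul_mem_right y _ ht)
    rw [sub_add_cancel] at h1
    exact (Ideal.ne_top_iff_one _).mp (IsLocalRing.maximalIdeal.isMaximal R).ne_top h1
  rw [← (Ideal.unit_mul_mem_iff_mem L hu), ← neg_mem_iff, ← Ideal.Quotient.eq_zero_iff_mem]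
  have hy' : Ideal.Quotient.mk L (t ^ n.succ * y) = Ideal.Quotient.mk L (t ^ n * 1) := hy
  rw [← sub_eq_zero, ← map_sub] at hy'
  rw [← hy']
  rw [pow_succ]
  congr 1
  ring

/-- A prime containing a non-zerodivisor is not minimal, so in dimension one it is maximal. -/
theorem radical_eq_maximalIdeal_of_isRegularIdeal [IsLocalRing R] [Ring.KrullDimLE 1 R]
    {Q : Ideal R} (hQ : IsRegularIdeal Q) (hne : Q ≠ ⊤) :
    Q.radical = IsLocalRing.maximalIdeal R := by
  have hmax : ∀ P : Ideal R, P.IsPrime → Q ≤ P → P = IsLocalRing.maximalIdeal R := by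
    intro P hP hQP
    rcases Ring.krullDimLE_one_iff.mp ‹_› P hP with hmin | hmax
    · obtain ⟨x, hxQ, hx⟩ := hQ
      exact absurd hx (Set.disjoint_left.mp
        (Ideal.disjoint_nonZeroDivisors_of_mem_minimalPrimes hmin) (hQP hxQ))
    · exact IsLocalRing.eq_maximalIdeal hmax
  apply le_antisymm
  · rw [(IsLocalRing.maximalIdeal.isMaximal R).isPrime.radical_le_iff]
    exact IsLocalRing.le_maximalIdeal hne
  · rw [Ideal.radical_eq_sInf]
    exact le_sInf fun P ⟨hQP, hP⟩ => (hmax P hP hQP).ge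

end Lengths

/-! ### Multiplication by fractions -/

section Fractions

variable {R : Type*} [CommRing R] {K : Type*} [CommRing K] [Algebra R K]

theorem mem_scale {α : K} {J : Ideal R} {z : K} :
    z ∈ scale α J ↔ ∃ x ∈ J, α * algebraMap R K x = z := by
  simp [scale]

theorem mem_colonRing {α : K} {I : Ideal R} :
    α ∈ colonRing K I ↔ ∀ x ∈ I, ∃ y : R, algebraMap R K y = α * algebraMap R K x := by
  simp [colonRing, Submodule.mem_div_iff_forall_mul_mem, Submodule.mem_one]

theorem mem_colonRing_of_coeSubmodule_eq_scale {α : K} {J L : Ideal R}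
    (h : coeSubmodule K L = scale α J) : α ∈ colonRing K J := mem_colonRing.mpr fun x hx => by
  obtain ⟨y, -, hy⟩ := (mem_coeSubmodule K L).mp (h ▸ mem_scale.mpr ⟨x, hx, rfl⟩)
  exact ⟨y, hy⟩

theorem coeSubmodule_pow (I : Ideal R) (m : ℕ) :
    coeSubmodule K (I ^ m) = coeSubmodule K I ^ m := by
  induction m with
  | zero => rw [pow_zero, pow_zero, Ideal.one_eq_top, coeSubmodule_top]
  | succ m ih => rw [pow_succ, pow_succ, coeSubmodule_mul, ih]

theorem one_mem_colonRing (I : Ideal R) : (1 : K) ∈ colonRing K I :=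
  mem_colonRing.mpr fun x _ => ⟨x, (one_mul _).symm⟩

theorem monotone_colonRing_pow (I : Ideal R) : Monotone fun n : ℕ => colonRing K I ^ n := by
  refine monotone_nat_of_le_succ fun n x hx => ?_
  rw [pow_succ, ← mul_one x]
  exact Submodule.mul_mem_mul hx (one_mem_colonRing I)

theorem coeSubmodule_eq_scale_trans {α β δ : K} {I J L : Ideal R}
    (hJ : coeSubmodule K J = scale β I) (hL : coeSubmodule K L = scale δ I) (h : α * β = δ) :
    coeSubmodule K L = scale α J := by
  rw [hL, scale, scale, hJ, scale, ← Submodule.map_comp, ← h]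
  congr 1
  ext z
  simp

theorem coeSubmodule_eq_scale_symm {α γ : K} {J L : Ideal R}
    (h : coeSubmodule K L = scale α J) (hγ : γ * α = 1) :
    coeSubmodule K J = scale γ L := by
  refine coeSubmodule_eq_scale_trans h ?_ hγ
  ext z
  simp [scale]

/-- The determinant trick for rings with zero divisors: a unit `u ∈ N` makes `N` faithful, because
`R[x] ⊆ u⁻¹ N`. -/
theorem isIntegral_of_mul_mem_of_fg [IsNoetherianRing R] {N : Submodule R K} (hN : N.FG) {u : K}
    (huN : u ∈ N) (hu : IsUnit u) {x : K} (hx : ∀ n ∈ N, x * n ∈ N) : IsIntegral R x := by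
  obtain ⟨w, hw⟩ := hu.exists_left_inv
  have hle : Subalgebra.toSubmodule (Algebra.adjoin R {x}) ≤ N.map (LinearMap.mulLeft R w) := by
    intro y hy
    have hy' : ∀ n ∈ N, y * n ∈ N := by
      induction hy using Algebra.adjoin_induction with
      | mem y hy => rwa [Set.mem_singleton_iff.mp hy]
      | algebraMap r =>
        intro n hn
        rw [← Algebra.smul_def]
        exact N.smul_mem r hn
      | add y z _ _ ihy ihz =>
        intro n hn
        rw [add_mul]
        exact N.add_mem (ihy n hn) (ihz n hn)
      | mul y z _ _ ihy ihz =>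
        intro n hn
        rw [mul_assoc]
        exact ihy _ (ihz n hn)
    refine ⟨y * u, hy' u huN, ?_⟩
    rw [LinearMap.mulLeft_apply, mul_left_comm, hw, mul_one]
  exact IsIntegral.of_mem_of_fg _ (Submodule.FG.of_le (hN.map (LinearMap.mulLeft R w)) hle) x
    (Algebra.self_mem_adjoin_singleton R x)

theorem coeSubmodule_range {I : Ideal R} {f : I →ₗ[R] R} {α : K}
    (hf : ∀ x : I, algebraMap R K (f x) = α * algebraMap R K x) :
    coeSubmodule K (LinearMap.range f) = scale α I := by
  ext z
  rw [mem_coeSubmodule, mem_scale]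
  constructor
  · rintro ⟨_, ⟨x, rfl⟩, rfl⟩
    exact ⟨x, x.2, (hf x).symm⟩
  · rintro ⟨x, hx, rfl⟩
    exact ⟨_, ⟨⟨x, hx⟩, rfl⟩, hf ⟨x, hx⟩⟩

variable [IsFractionRing R K]

theorem isUnit_algebraMap {x : R} (hx : x ∈ nonZeroDivisors R) : IsUnit (algebraMap R K x) :=
  IsLocalization.map_units K (⟨x, hx⟩ : nonZeroDivisors R)

theorem mem_nonZeroDivisors_of_isUnit_algebraMap {x : R} (hx : IsUnit (algebraMap R K x)) :
    x ∈ nonZeroDivisors R := by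
  refine mem_nonZeroDivisors_iff_right.mpr fun y hy => IsFractionRing.injective R K ?_
  rw [map_zero, ← hx.mul_left_eq_zero, ← map_mul, hy, map_zero]

theorem algebraMap_mem_coeSubmodule {J : Ideal R} {x : R} :
    algebraMap R K x ∈ coeSubmodule K J ↔ x ∈ J := by
  rw [mem_coeSubmodule]
  exact ⟨fun ⟨y, hy, h⟩ => IsFractionRing.injective R K h ▸ hy, fun h => ⟨x, h, rfl⟩⟩

/-- The multiplier is `f(x₀)/x₀` for a non-zerodivisor `x₀ ∈ I`, since `x₀ f(x) = x f(x₀)`. -/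
theorem exists_mem_colonRing_of_linearMap {I : Ideal R} (hI : IsRegularIdeal I) (f : I →ₗ[R] R) :
    ∃ α ∈ colonRing K I, ∀ x : I, algebraMap R K (f x) = α * algebraMap R K x := by
  obtain ⟨x₀, hx₀, hreg⟩ := hI
  obtain ⟨w, hw⟩ := (isUnit_algebraMap (K := K) hreg).exists_left_inv
  have key : ∀ x : I, algebraMap R K (f x) =
      (w * algebraMap R K (f ⟨x₀, hx₀⟩)) * algebraMap R K x := by
    intro x
    have h : x₀ * f x = x * f ⟨x₀, hx₀⟩ := by
      rw [← smul_eq_mul, ← smul_eq_mul, ← map_smul, ← map_smul]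
      congr 1
      exact Subtype.ext (mul_comm _ _)
    have h' := congrArg (algebraMap R K) h
    rw [map_mul, map_mul] at h'
    linear_combination w * h' - algebraMap R K (f x) * hw
  exact ⟨_, mem_colonRing.mpr fun x hx => ⟨f ⟨x, hx⟩, key ⟨x, hx⟩⟩, key⟩

theorem exists_linearMap_of_mem_colonRing {I : Ideal R} {α : K} (hα : α ∈ colonRing K I) :
    ∃ f : I →ₗ[R] R, ∀ x : I, algebraMap R K (f x) = α * algebraMap R K x := by
  choose g hg using mem_colonRing.mp hα
  refine ⟨{ toFun := fun x => g x x.2, map_add' := ?_, map_smul' := ?_ }, fun x => hg x x.2⟩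
  · intro x y
    apply IsFractionRing.injective R K
    simp [hg, mul_add]
  · intro r x
    apply IsFractionRing.injective R K
    simp [hg, mul_left_comm]

theorem exists_coeSubmodule_eq_scale {I : Ideal R} {α : K} (hα : α ∈ colonRing K I) :
    ∃ f : I →ₗ[R] R, coeSubmodule K (LinearMap.range f) = scale α I := by
  obtain ⟨f, hf⟩ := exists_linearMap_of_mem_colonRing hα
  exact ⟨f, coeSubmodule_range hf⟩

theorem coeSubmodule_traceIdeal {I : Ideal R} (hI : IsRegularIdeal I) :
    coeSubmodule K (traceIdeal R I) = colonRing K I * coeSubmodule K I := by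
  apply le_antisymm
  · rw [coeSubmodule, Submodule.map_le_iff_le_comap, traceIdeal, iSup_le_iff]
    rintro f _ ⟨x, rfl⟩
    obtain ⟨α, hα, hf⟩ := exists_mem_colonRing_of_linearMap (K := K) hI f
    change algebraMap R K (f x) ∈ colonRing K I * coeSubmodule K I
    rw [hf]
    exact Submodule.mul_mem_mul hα (algebraMap_mem_coeSubmodule.mpr x.2)
  · rw [Submodule.mul_le]
    intro α hα z hz
    obtain ⟨x, hx, rfl⟩ := (mem_coeSubmodule K I).mp hz
    obtain ⟨f, hf⟩ := exists_linearMap_of_mem_colonRing hα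
    rw [← hf ⟨x, hx⟩, algebraMap_mem_coeSubmodule]
    exact (le_iSup (fun f : I →ₗ[R] R => LinearMap.range f) f) ⟨_, rfl⟩

theorem colonRing_fg [IsNoetherianRing R] {I : Ideal R} (hI : IsRegularIdeal I) :
    (colonRing K I).FG := by
  obtain ⟨x₀, hx₀, hreg⟩ := hI
  obtain ⟨w, hw⟩ := (isUnit_algebraMap (K := K) hreg).exists_left_inv
  have h1 : ((1 : Submodule R K).map (LinearMap.mulLeft R w)).FG :=
    Submodule.FG.map _ (Submodule.one_eq_span (R := R) (A := K) ▸ Submodule.fg_span_singleton 1)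
  refine Submodule.FG.of_le h1 fun α hα => ?_
  obtain ⟨y, hy⟩ := mem_colonRing.mp hα x₀ hx₀
  refine ⟨algebraMap R K y, Submodule.algebraMap_mem y, ?_⟩
  rw [LinearMap.mulLeft_apply, hy, mul_left_comm, hw, mul_one]

/-- Multiplying a regular ideal `J` by an integral unit `β` of `K`, with inverse `γ`, does not
decrease the colength, and preserves it only if `γ` is integral too. -/
theorem length_le_of_coeSubmodule_eq_scale [IsNoetherianRing R] [Ring.KrullDimLE 1 R]
    {β γ : K} (hβγ : γ * β = 1) (hβ : IsIntegral R β) {J L : Ideal R} (hJ : IsRegularIdeal J)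
    (hL : coeSubmodule K L = scale β J) :
    Module.length R (R ⧸ J) ≤ Module.length R (R ⧸ L) ∧
      (Module.length R (R ⧸ L) ≤ Module.length R (R ⧸ J) → IsIntegral R γ) := by
  have hβJ := mem_colonRing_of_coeSubmodule_eq_scale hL
  obtain ⟨f, hf⟩ := exists_linearMap_of_mem_colonRing hβJ
  have hfL : LinearMap.range f = L :=
    IsFractionRing.coeSubmodule_injective R K ((coeSubmodule_range hf).trans hL.symm)
  have hinj : Function.Injective f := fun x y hxy => by
    have h := congrArg (fun z => γ * algebraMap R K z) hxy
    simp only [hf, ← mul_assoc, hβγ, one_mul] at h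
    exact Subtype.ext (IsFractionRing.injective R K h)
  let e : J ≃ₗ[R] L := (LinearEquiv.ofInjective f hinj).trans (LinearEquiv.ofEq _ _ hfL)
  have he : ∀ x, algebraMap R K (e x) = β * algebraMap R K x := hf
  -- The largest ideal contained in `J` and stable under `β`.
  let D : Ideal R :=
    { carrier := {x | ∀ i : ℕ, β ^ i * algebraMap R K x ∈ coeSubmodule K J}
      add_mem' := fun hx hy i => by
        rw [map_add, mul_add]; exact Submodule.add_mem _ (hx i) (hy i)
      zero_mem' := fun i => by rw [map_zero, mul_zero]; exact Submodule.zero_mem _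
      smul_mem' := fun r x hx i => by
        rw [smul_eq_mul, map_mul, mul_left_comm, ← Algebra.smul_def]
        exact Submodule.smul_mem _ r (hx i) }
  have hDJ : D ≤ J := fun x hx => by
    have h := hx 0
    rwa [pow_zero, one_mul, algebraMap_mem_coeSubmodule] at h
  have hDreg : IsRegularIdeal D := by
    obtain ⟨x, hx, hxreg⟩ := hJ
    -- A common denominator `d` of `R[β]` gives `d J ⊆ D`.
    obtain ⟨d, hd, hint⟩ := FractionalIdeal.isFractional_adjoin_integral (nonZeroDivisors R) β hβ
    refine ⟨d * x, fun i => ?_, mul_mem hd hxreg⟩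
    obtain ⟨y, hy⟩ := hint (β ^ i) (pow_mem (Algebra.self_mem_adjoin_singleton R β) i)
    rw [map_mul, ← mul_assoc, mul_comm (β ^ i), ← Algebra.smul_def, ← hy, ← map_mul,
      algebraMap_mem_coeSubmodule]
    exact J.mul_mem_left y hx
  -- The ideal `β D`.
  let D' : Ideal R := ((D.submoduleOf J).map e.toLinearMap).map L.subtype
  have hD'mem : ∀ y ∈ D', ∃ x ∈ D, algebraMap R K y = β * algebraMap R K x := by
    rintro _ ⟨_, ⟨x, hx, rfl⟩, rfl⟩
    exact ⟨x, hx, he x⟩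
  have hmemD' : ∀ x (hx : x ∈ D), (e ⟨x, hDJ hx⟩ : R) ∈ D' := fun x hx =>
    ⟨_, ⟨⟨x, hDJ hx⟩, hx, rfl⟩, rfl⟩
  have hD'L : D' ≤ L := Submodule.map_subtype_le _ _
  have hD'D : D' ≤ D := fun y hy i => by
    obtain ⟨x, hx, hxy⟩ := hD'mem y hy
    rw [hxy, ← mul_assoc, ← pow_succ]
    exact hx (i + 1)
  have hcomap : (D.submoduleOf J).map e.toLinearMap = D'.submoduleOf L :=
    (Submodule.comap_map_eq_of_injective L.injective_subtype _).symm
  have hDfin := length_quotient_ne_top hDreg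
  have hJlen := length_quotient_eq_add hDJ
  have hLlen := length_quotient_eq_add hD'L
  rw [← (Submodule.Quotient.equiv _ _ e hcomap).length_eq] at hLlen
  have hDlen := length_quotient_eq_add hD'D
  have hfin : Module.length R (J ⧸ D.submoduleOf J) ≠ ⊤ := fun h => by
    rw [h, top_add] at hJlen
    exact hDfin hJlen
  have hle : Module.length R (R ⧸ D) ≤ Module.length R (R ⧸ D') := hDlen ▸ le_add_self
  refine ⟨?_, fun h => ?_⟩
  · rw [hJlen, hLlen] at hle
    exact (ENat.add_le_add_iff_left hfin).mp hle
  · have hDD' : D' = D := eq_of_length_quotient_le hD'D hDfin (by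
      rw [hJlen, hLlen]
      gcongr)
    obtain ⟨x₀, hx₀, hreg⟩ := hDreg
    refine isIntegral_of_mul_mem_of_fg (N := coeSubmodule K D)
      ((coeSubmodule_fg _ (IsFractionRing.injective R K) D).mpr (IsNoetherian.noetherian D))
      (algebraMap_mem_coeSubmodule.mpr hx₀) (isUnit_algebraMap hreg) fun z hz => ?_
    obtain ⟨y, hy, rfl⟩ := (mem_coeSubmodule K D).mp hz
    obtain ⟨x, hx, hxy⟩ := hD'mem y (hDD' ▸ hy)
    rw [hxy, ← mul_assoc, hβγ, one_mul]
    exact algebraMap_mem_coeSubmodule.mpr hx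

end Fractions

/-! ### Partial trace ideals -/

section PartialTraceIdeals

variable {R : Type*} [CommRing R]

theorem isPartialTraceIdealOf_iff {M : Type*} [AddCommGroup M] [Module R M] {J : Ideal R} :
    IsPartialTraceIdealOf M J ↔ ∃ f : M →ₗ[R] R, J = LinearMap.range f ∧
      ∀ g : M →ₗ[R] R, Module.length R (R ⧸ J) ≤ Module.length R (R ⧸ LinearMap.range g) := by
  refine exists_congr fun f => and_congr_right fun hf => ?_
  subst hf
  exact ⟨fun h g => h ▸ iInf_le _ g, fun h => le_antisymm (le_iInf h) (iInf_le _ f)⟩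

theorem isPartialTraceIdealOf_self_iff {I : Ideal R} :
    IsPartialTraceIdealOf I I ↔
      ∀ g : I →ₗ[R] R, Module.length R (R ⧸ I) ≤ Module.length R (R ⧸ LinearMap.range g) := by
  rw [isPartialTraceIdealOf_iff]
  exact ⟨fun ⟨_, _, h⟩ => h, fun h => ⟨I.subtype, I.range_subtype.symm, h⟩⟩

/-- If `I = Im f` for `f : M → R`, each `g : I → R` gives the competitor `g ∘ f : M → R`, whose image
is that of `g`. -/
theorem IsPartialTraceIdealOf.self {M : Type*} [AddCommGroup M] [Module R M] {I : Ideal R}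
    (h : IsPartialTraceIdealOf M I) : IsPartialTraceIdealOf I I := by
  obtain ⟨f, hf, hmin⟩ := isPartialTraceIdealOf_iff.mp h
  refine isPartialTraceIdealOf_self_iff.mpr fun g => ?_
  have hfI : ∀ x, f x ∈ I := fun x => hf ▸ ⟨x, rfl⟩
  refine (hmin (g ∘ₗ f.codRestrict I hfI)).trans_eq ?_
  have hsurj : LinearMap.range (f.codRestrict I hfI) = ⊤ := by
    rw [LinearMap.range_eq_top]
    rintro ⟨y, hy⟩
    obtain ⟨x, rfl⟩ := hf ▸ hy
    exact ⟨x, rfl⟩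
  rw [LinearMap.range_comp_of_range_eq_top g hsurj]

theorem isPartialTraceIdeal_iff {R : Type u} [CommRing R] [IsNoetherianRing R] {I : Ideal R} :
    IsPartialTraceIdeal I ↔ IsPartialTraceIdealOf I I :=
  ⟨fun ⟨_, _, _, _, h⟩ => h.self, fun h => ⟨I, _, _, inferInstance, h⟩⟩

theorem le_traceIdeal (I : Ideal R) : I ≤ traceIdeal R I :=
  I.range_subtype.symm.le.trans (le_iSup (fun f : I →ₗ[R] R => LinearMap.range f) I.subtype)

end PartialTraceIdeals

/-! ### Integrality of the colon -/

section Colon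

variable {R : Type*} [CommRing R] {K : Type*} [CommRing K] [Algebra R K] [IsFractionRing R K]

theorem isUnit_of_coeSubmodule_eq_scale {α : K} {J L : Ideal R}
    (h : coeSubmodule K L = scale α J) (hL : IsRegularIdeal L) : IsUnit α := by
  obtain ⟨y, hy, hreg⟩ := hL
  obtain ⟨x, -, hx⟩ := mem_scale.mp (h ▸ algebraMap_mem_coeSubmodule.mpr hy)
  exact isUnit_of_mul_isUnit_left (hx ▸ isUnit_algebraMap hreg)

theorem isRegularIdeal_of_coeSubmodule_eq_scale {α : K} {J L : Ideal R}
    (h : coeSubmodule K L = scale α J) (hJ : IsRegularIdeal J) (hα : IsUnit α) :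
    IsRegularIdeal L := by
  obtain ⟨x, hx, hreg⟩ := hJ
  obtain ⟨y, hy, hxy⟩ := (mem_coeSubmodule K L).mp (h ▸ mem_scale.mpr ⟨x, hx, rfl⟩)
  exact ⟨y, hy, mem_nonZeroDivisors_of_isUnit_algebraMap
    (hxy ▸ hα.mul (isUnit_algebraMap hreg))⟩

theorem isPartialTraceIdealOf_self_of_colonRing_subset [IsLocalRing R] [IsNoetherianRing R]
    [Ring.KrullDimLE 1 R] {t : R} (ht : t ∈ IsLocalRing.maximalIdeal R)
    (ht' : t ∈ nonZeroDivisors R) {I : Ideal R} (hI : IsRegularIdeal I)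
    (h : (colonRing K I : Set K) ⊆ integralClosure R K) : IsPartialTraceIdealOf I I := by
  refine isPartialTraceIdealOf_self_iff.mpr fun g => ?_
  by_cases hfin : Module.length R (R ⧸ LinearMap.range g) = ⊤
  · exact hfin ▸ le_top
  obtain ⟨α, hα, hg⟩ := exists_mem_colonRing_of_linearMap (K := K) hI g
  have hscale := coeSubmodule_range hg
  obtain ⟨γ, hγ⟩ := (isUnit_of_coeSubmodule_eq_scale hscale
    (isRegularIdeal_of_length_quotient_ne_top ht ht' hfin)).exists_left_inv
  exact (length_le_of_coeSubmodule_eq_scale hγ (h hα) hI hscale).1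

theorem isReduction_traceIdeal_of_colonRing_subset [IsNoetherianRing R] {I : Ideal R}
    (hI : IsRegularIdeal I) (h : (colonRing K I : Set K) ⊆ integralClosure R K) :
    IsReduction I (traceIdeal R I) := by
  set C := colonRing K I with hC
  obtain ⟨s, hs⟩ := colonRing_fg (K := K) hI
  rw [← hC] at hs
  have hAfg : (Subalgebra.toSubmodule (Algebra.adjoin R (s : Set K))).FG :=
    fg_adjoin_of_finite s.finite_toSet fun x hx => h (hs ▸ Submodule.subset_span hx)
  have hCA : C ≤ Subalgebra.toSubmodule (Algebra.adjoin R (s : Set K)) := by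
    rw [← hs, Submodule.span_le]
    exact Algebra.subset_adjoin
  generalize Algebra.adjoin R (s : Set K) = A at hAfg hCA
  have hpow : ∀ n : ℕ, C ^ n ≤ Subalgebra.toSubmodule A := fun n => by
    induction n with
    | zero => rw [pow_zero, Submodule.one_le]; exact A.one_mem
    | succ n ih =>
      rw [pow_succ, Submodule.mul_le]
      exact fun x hx y hy => A.mul_mem (ih hx) (hCA hy)
  have hmono : Monotone fun n : ℕ => C ^ n := monotone_colonRing_pow I
  have : IsNoetherian R (Subalgebra.toSubmodule A) := isNoetherian_of_fg_of_noetherian _ hAfg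
  obtain ⟨n, hn⟩ := monotone_stabilizes_iff_noetherian.mpr this
    ⟨fun n => (C ^ n).submoduleOf (Subalgebra.toSubmodule A),
      fun m n hmn => Submodule.comap_mono (hmono hmn)⟩
  have hstab : ∀ m, n ≤ m → C ^ m = C ^ n := fun m hm => by
    refine le_antisymm (fun x hx => ?_) (hmono hm)
    have hx' : (⟨x, hpow m hx⟩ : Subalgebra.toSubmodule A) ∈
        (C ^ m).submoduleOf (Subalgebra.toSubmodule A) := hx
    rw [show (C ^ m).submoduleOf (Subalgebra.toSubmodule A) = _ from (hn m hm).symm] at hx'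
    exact hx'
  refine ⟨le_traceIdeal I, n + 1, n.succ_pos, IsFractionRing.coeSubmodule_injective R K ?_⟩
  have hcoe : ∀ m : ℕ, coeSubmodule K (traceIdeal R I ^ m) = C ^ m * coeSubmodule K I ^ m := by
    intro m
    rw [coeSubmodule_pow, coeSubmodule_traceIdeal hI, ← hC, mul_pow]
  rw [hcoe, coeSubmodule_mul, hcoe, hstab (n + 1 + 1) (by omega), hstab (n + 1) (by omega)]
  ring

theorem colonRing_subset_of_isReduction_traceIdeal [IsNoetherianRing R] {I : Ideal R}
    (hI : IsRegularIdeal I) (h : IsReduction I (traceIdeal R I)) :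
    (colonRing K I : Set K) ⊆ integralClosure R K := by
  obtain ⟨hle, n, -, hn⟩ := h
  have hfg : (coeSubmodule K (I * traceIdeal R I ^ n)).FG :=
    (coeSubmodule_fg _ (IsFractionRing.injective R K) _).mpr (IsNoetherian.noetherian _)
  have hmul : colonRing K I * coeSubmodule K (I * traceIdeal R I ^ n) =
      coeSubmodule K (I * traceIdeal R I ^ n) := by
    nth_rewrite 2 [← hn]
    rw [coeSubmodule_mul, ← mul_assoc, ← coeSubmodule_traceIdeal hI, ← coeSubmodule_mul, pow_succ']
  obtain ⟨x, hx, hreg⟩ := hI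
  exact fun α hα => isIntegral_of_mul_mem_of_fg hfg
    (algebraMap_mem_coeSubmodule.mpr (Ideal.mul_mem_mul hx (Ideal.pow_mem_pow (hle hx) n)))
    (isUnit_algebraMap (mul_mem hreg (pow_mem hreg n)))
    fun z hz => hmul ▸ Submodule.mul_mem_mul hα hz

/-- For a non-zerodivisor `x ∈ I`, the ideal `t x (R : I)` is proper and contains `t x`, so it is
`𝔪`-primary; a principal reduction of it, divided by `t x`, is one of the fractional ideal `R : I`. -/
theorem exists_pow_succ_colonRing_eq [IsLocalRing R] [Ring.KrullDimLE 1 R]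
    {t : R} (ht : t ∈ IsLocalRing.maximalIdeal R) (ht' : t ∈ nonZeroDivisors R)
    (hred : ∀ Q : Ideal R, IsMaximalPrimary Q → HasPrincipalReduction Q)
    {I : Ideal R} (hI : IsRegularIdeal I) :
    ∃ α ∈ colonRing K I, ∃ n : ℕ,
      colonRing K I ^ (n + 1) = Submodule.span R {α} * colonRing K I ^ n := by
  obtain ⟨x, hx, hreg⟩ := hI
  set C := colonRing K I with hC
  set X : K := algebraMap R K (t * x) with hX
  obtain ⟨w, hw⟩ := (isUnit_algebraMap (K := K) (mul_mem ht' hreg)).exists_left_inv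
  rw [← hX] at hw
  have hwX : Submodule.span R {w} * Submodule.span R {X} = (1 : Submodule R K) := by
    rw [Submodule.span_mul_span, Set.singleton_mul_singleton, hw, Submodule.one_eq_span]
  -- The factor `t` in `X` makes `Q` a proper ideal, even if `x (R : I) = R`.
  let Q : Ideal R := (Submodule.span R {X} * C).comap (Algebra.linearMap R K)
  have hXC : ∀ z, z ∈ Submodule.span R {X} * C ↔ ∃ c ∈ C, X * c = z := fun z =>
    Submodule.mem_span_singleton_mul
  have hXc : ∀ c ∈ C, ∃ y, algebraMap R K (t * y) = X * c := fun c hc => by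
    obtain ⟨y, hy⟩ := mem_colonRing.mp hc x hx
    exact ⟨y, by rw [hX, map_mul, map_mul, hy]; ring⟩
  have hQ : coeSubmodule K Q = Submodule.span R {X} * C := by
    refine le_antisymm (Submodule.map_comap_le _ _) fun z hz => ?_
    obtain ⟨c, hc, rfl⟩ := (hXC z).mp hz
    obtain ⟨y, hy⟩ := hXc c hc
    rw [← hy] at hz ⊢
    exact algebraMap_mem_coeSubmodule.mpr hz
  have hQreg : IsRegularIdeal Q :=
    ⟨t * x, (hXC _).mpr ⟨1, one_mem_colonRing I, mul_one _⟩, mul_mem ht' hreg⟩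
  have hQm : Q ≤ IsLocalRing.maximalIdeal R := fun q hq => by
    obtain ⟨c, hc, hcq⟩ := (hXC _).mp hq
    obtain ⟨y, hy⟩ := hXc c hc
    rw [← IsFractionRing.injective R K (hy.trans hcq)]
    exact Ideal.mul_mem_right y _ ht
  have hrad := radical_eq_maximalIdeal_of_isRegularIdeal hQreg
    (ne_top_of_le_ne_top (IsLocalRing.maximalIdeal.isMaximal R).ne_top hQm)
  obtain ⟨a, hle, n, -, hn⟩ := hred Q ⟨Ideal.isPrimary_of_isMaximal_radical
    (hrad ▸ IsLocalRing.maximalIdeal.isMaximal R), hrad⟩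
  obtain ⟨α, hα, hαa⟩ := (hXC _).mp (hle (Ideal.mem_span_singleton_self a))
  refine ⟨α, hα, n, ?_⟩
  have hcoe : ∀ m : ℕ, coeSubmodule K (Q ^ m) = Submodule.span R {X} ^ m * C ^ m := by
    intro m
    rw [coeSubmodule_pow, hQ, mul_pow]
  have ha : coeSubmodule K (Ideal.span {a}) =
      Submodule.span R {X} * Submodule.span R {α} := by
    rw [coeSubmodule_span_singleton, Submodule.span_mul_span, Set.singleton_mul_singleton, hαa]
    rfl
  have hn' := congrArg (fun P => Submodule.span R {w} ^ (n + 1) * coeSubmodule K P) hn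
  simp only [coeSubmodule_mul, hcoe, ha] at hn'
  have hpow : Submodule.span R {w} ^ (n + 1) * Submodule.span R {X} ^ (n + 1) =
      (1 : Submodule R K) := by
    rw [← mul_pow, hwX, one_pow]
  calc C ^ (n + 1)
      = Submodule.span R {w} ^ (n + 1) * (Submodule.span R {X} ^ (n + 1) * C ^ (n + 1)) := by
        rw [← mul_assoc, hpow, one_mul]
    _ = Submodule.span R {w} ^ (n + 1) * Submodule.span R {X} ^ (n + 1) *
          (Submodule.span R {α} * C ^ n) := by
        rw [hn']
        ring
    _ = _ := by rw [hpow, one_mul]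

theorem colonRing_subset_of_isPartialTraceIdealOf_self [IsLocalRing R] [IsNoetherianRing R]
    [Ring.KrullDimLE 1 R]
    {t : R} (ht : t ∈ IsLocalRing.maximalIdeal R) (ht' : t ∈ nonZeroDivisors R)
    (hred : ∀ Q : Ideal R, IsMaximalPrimary Q → HasPrincipalReduction Q)
    {I : Ideal R} (hI : IsRegularIdeal I) (h : IsPartialTraceIdealOf I I) :
    (colonRing K I : Set K) ⊆ integralClosure R K := by
  obtain ⟨α, hα, n, hn⟩ := exists_pow_succ_colonRing_eq (K := K) ht ht' hred hI
  have h1 : ∀ m : ℕ, (1 : K) ∈ colonRing K I ^ m := fun m => by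
    simpa using Submodule.pow_mem_pow _ (one_mem_colonRing (K := K) I) m
  have hmem : ∀ z ∈ colonRing K I ^ (n + 1), ∃ c ∈ colonRing K I ^ n, α * c = z := fun z hz =>
    Submodule.mem_span_singleton_mul.mp (hn ▸ hz)
  obtain ⟨γ, -, hγ⟩ := hmem 1 (h1 _)
  have hCfg : (colonRing K I ^ n).FG := (colonRing_fg hI).pow n
  have hsucc : colonRing K I ^ n ≤ colonRing K I ^ (n + 1) :=
    monotone_colonRing_pow I n.le_succ
  -- `C ^ n ⊆ C ^ (n + 1) = α C ^ n`, so `γ = α⁻¹` maps `C ^ n` into itself.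
  have hγint : IsIntegral R γ := by
    refine isIntegral_of_mul_mem_of_fg hCfg (h1 n) isUnit_one fun z hz => ?_
    obtain ⟨c, hc, rfl⟩ := hmem z (hsucc hz)
    rwa [← mul_assoc, mul_comm γ, hγ, one_mul]
  obtain ⟨f, hf⟩ := exists_coeSubmodule_eq_scale hα
  -- Length comparison for `I = γ (α I)`, together with the minimality of `ℓ(R/I)`.
  have hαint : IsIntegral R α :=
    (length_le_of_coeSubmodule_eq_scale hγ hγint
      (isRegularIdeal_of_coeSubmodule_eq_scale hf hI (IsUnit.of_mul_eq_one γ hγ))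
      (coeSubmodule_eq_scale_symm hf ((mul_comm γ α).trans hγ))).2
      (isPartialTraceIdealOf_self_iff.mp h f)
  intro c hc
  -- `C` maps `R[α] C ^ n` into itself, as `C ^ (n + 1) = α C ^ n`.
  refine isIntegral_of_mul_mem_of_fg (hαint.fg_adjoin_singleton.mul hCfg)
    (Submodule.mul_mem_mul (one_mem (Algebra.adjoin R {α})) (h1 n))
    (by rw [mul_one]; exact isUnit_one) fun z hz => ?_
  induction hz using Submodule.mul_induction_on' with
  | mem_mul_mem s hs y hy =>
    obtain ⟨y', hy', hyy'⟩ := hmem (c * y)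
      (pow_succ' (colonRing K I) n ▸ Submodule.mul_mem_mul hc hy)
    rw [mul_left_comm, ← hyy', ← mul_assoc]
    exact Submodule.mul_mem_mul
      (mul_mem (S := Subalgebra R K) hs (Algebra.self_mem_adjoin_singleton R α)) hy'
  | add x _ y _ hx hy =>
    rw [mul_add]
    exact Submodule.add_mem _ hx hy

end Colon

/-! ### The valuation on the integral closure -/

section Valuation

variable {R : Type*} [CommRing R] {K : Type*} [CommRing K] [Algebra R K] [IsFractionRing R K]

theorem ord_eq_zero_iff_isUnit {S : Type*} [CommRing S] {x : S} : Ring.ord S x = 0 ↔ IsUnit x := by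
  rw [Ring.ord, Module.length_eq_zero_iff, Submodule.Quotient.subsingleton_iff,
    Ideal.span_singleton_eq_top]

theorem algebraMap_integralClosure_mem_nonZeroDivisors (b : nonZeroDivisors R) :
    algebraMap R (integralClosure R K) b ∈ nonZeroDivisors (integralClosure R K) := by
  refine mem_nonZeroDivisors_iff_right.mpr fun z hz => Subtype.ext ?_
  have h := congrArg (algebraMap (integralClosure R K) K) hz
  rw [map_mul, ← IsScalarTower.algebraMap_apply, map_zero] at h
  exact (isUnit_algebraMap (K := K) b.2).mul_left_eq_zero.mp h

/-- The elements of valuation zero are the units of the integral closure. -/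
theorem normalizedVal_eq_zero_iff [IsDomain (integralClosure R K)]
    [IsDiscreteValuationRing (integralClosure R K)] {α : K} :
    normalizedVal R α = 0 ↔ IsIntegral R α ∧ ∃ γ : K, γ * α = 1 ∧ IsIntegral R γ := by
  obtain ⟨⟨a, b⟩, hab⟩ := IsLocalization.surj (nonZeroDivisors R) α
  have hb := algebraMap_integralClosure_mem_nonZeroDivisors (K := K) b
  have hval : normalizedVal R α = 0 ↔
      Ring.ord (integralClosure R K) (algebraMap R (integralClosure R K) a) =
        Ring.ord (integralClosure R K) (algebraMap R (integralClosure R K) b) := by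
    rw [normalizedVal_eq α a b hab]
    have hbtop := Ring.ord_ne_top hb
    generalize Ring.ord (integralClosure R K) (algebraMap R (integralClosure R K) a) = A
    generalize Ring.ord (integralClosure R K) (algebraMap R (integralClosure R K) b) = B at hbtop ⊢
    lift B to ℕ using hbtop
    induction A using ENat.recTopCoe with
    | top => simp
    | coe a =>
      simp only [ENat.map_natCast]
      rw [← WithTop.LinearOrderedAddCommGroup.coe_sub, WithTop.coe_eq_zero, sub_eq_zero]
      norm_cast
  rw [hval]
  have hcoe : ∀ r : R, ((algebraMap R (integralClosure R K) r : integralClosure R K) : K) =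
      algebraMap R K r := fun r => rfl
  constructor
  · intro h
    have hassoc : Associated (algebraMap R (integralClosure R K) b)
        (algebraMap R (integralClosure R K) a) := by
      have hunit : ∀ p q c : integralClosure R K, q ∈ nonZeroDivisors (integralClosure R K) →
          p = q * c → Ring.ord (integralClosure R K) p = Ring.ord (integralClosure R K) q →
          Associated q p := by
        rintro p q c hq rfl hpq
        rw [Ring.ord_mul' _ hq] at hpq
        have hc : Ring.ord (integralClosure R K) c = 0 := by
          rw [← ENat.add_left_injective_of_ne_top (Ring.ord_ne_top hq) |>.eq_iff]
          simpa [add_comm] using hpq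
        obtain ⟨u, rfl⟩ := ord_eq_zero_iff_isUnit.mp hc
        exact ⟨u, rfl⟩
      rcases ValuationRing.dvd_total (algebraMap R (integralClosure R K) b)
        (algebraMap R (integralClosure R K) a) with ⟨c, hc⟩ | ⟨c, hc⟩
      · exact hunit _ _ c hb hc h
      · refine (hunit _ _ c (mem_nonZeroDivisors_of_ne_zero fun h0 => ?_) hc h.symm).symm
        rw [h0, zero_mul] at hc
        exact nonZeroDivisors.ne_zero hb hc
    obtain ⟨u, hu⟩ := hassoc
    have hαu : α = (u : integralClosure R K) := by
      apply (isUnit_algebraMap (K := K) b.2).mul_right_cancel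
      rw [hab, ← hcoe, ← hu, mul_comm]
      rfl
    rw [hαu]
    refine ⟨(u : integralClosure R K).2, ((u⁻¹ : (integralClosure R K)ˣ) : integralClosure R K),
      ?_, ((u⁻¹ : (integralClosure R K)ˣ) : integralClosure R K).2⟩
    exact congrArg Subtype.val u.inv_mul
  · rintro ⟨hα, γ, hγα, hγ⟩
    let α' : integralClosure R K := ⟨α, hα⟩
    have hu : IsUnit α' := IsUnit.of_mul_eq_one (⟨γ, hγ⟩ : integralClosure R K)
      (Subtype.ext ((mul_comm α γ).trans hγα))
    have hab' : algebraMap R (integralClosure R K) a =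
        algebraMap R (integralClosure R K) b * α' :=
      Subtype.ext (hab.symm.trans (mul_comm _ _))
    rw [hab', Ring.ord_mul' _ hb, ord_eq_zero_iff_isUnit.mpr hu, add_zero]

theorem isIntegral_or_isIntegral_inv [IsDomain (integralClosure R K)]
    [ValuationRing (integralClosure R K)] {α γ : K} (h : γ * α = 1) :
    IsIntegral R α ∨ IsIntegral R γ := by
  obtain ⟨⟨a, b⟩, hab⟩ := IsLocalization.surj (nonZeroDivisors R) α
  have hb := isUnit_algebraMap (K := K) b.2
  rcases ValuationRing.dvd_total (algebraMap R (integralClosure R K) b)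
    (algebraMap R (integralClosure R K) a) with ⟨c, hc⟩ | ⟨c, hc⟩
  · left
    have hc' : algebraMap R K a = algebraMap R K b * c := congrArg Subtype.val hc
    have : α = c := hb.mul_right_cancel (by rw [hab, hc', mul_comm])
    exact this ▸ c.2
  · right
    have hc' : algebraMap R K b = algebraMap R K a * c := congrArg Subtype.val hc
    have : γ = c := hb.mul_left_cancel (by
      simp only at hab
      linear_combination γ * hc' - γ * c * hab + algebraMap R K b * c * h)
    exact this ▸ c.2

/-- Whichever of `α`, `α⁻¹` is integral, the length comparison applies to it. -/
theorem length_eq_of_coeSubmodule_eq_scale_iff [IsNoetherianRing R] [Ring.KrullDimLE 1 R]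
    [IsDomain (integralClosure R K)] [IsDiscreteValuationRing (integralClosure R K)]
    {α : K} {J L : Ideal R} (hJ : IsRegularIdeal J) (hα : IsUnit α)
    (h : coeSubmodule K L = scale α J) :
    Module.length R (R ⧸ L) = Module.length R (R ⧸ J) ↔ normalizedVal R α = 0 := by
  obtain ⟨γ, hγ⟩ := hα.exists_left_inv
  have hL := isRegularIdeal_of_coeSubmodule_eq_scale h hJ hα
  have h' := coeSubmodule_eq_scale_symm h hγ
  have hγ' : α * γ = 1 := (mul_comm α γ).trans hγ
  rw [normalizedVal_eq_zero_iff]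
  constructor
  · intro hlen
    rcases isIntegral_or_isIntegral_inv (R := R) hγ with hint | hint
    · exact ⟨hint, γ, hγ, (length_le_of_coeSubmodule_eq_scale hγ hint hJ h).2 hlen.le⟩
    · exact ⟨(length_le_of_coeSubmodule_eq_scale hγ' hint hL h').2 hlen.ge, γ, hγ, hint⟩
  · rintro ⟨hint, γ', hγα, hint'⟩
    have : γ' = γ := hα.mul_right_cancel (hγα.trans hγ.symm)
    subst this
    exact le_antisymm (length_le_of_coeSubmodule_eq_scale hγ' hint' hL h').1
      (length_le_of_coeSubmodule_eq_scale hγ hint hJ h).1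

theorem setOf_isPartialTraceIdealOf_eq [IsLocalRing R] [IsNoetherianRing R] [Ring.KrullDimLE 1 R]
    [IsDomain (integralClosure R K)] [IsDiscreteValuationRing (integralClosure R K)]
    {t : R} (ht : t ∈ IsLocalRing.maximalIdeal R) (ht' : t ∈ nonZeroDivisors R)
    {I : Ideal R} (hI : IsRegularIdeal I) {J : Ideal R} (hJ : IsPartialTraceIdealOf I J) :
    {L : Ideal R | IsPartialTraceIdealOf I L} =
      {L : Ideal R | ∃ α ∈ colonRing K J, normalizedVal R α = 0 ∧
        coeSubmodule K L = scale α J} := by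
  have hreg : ∀ L : Ideal R, IsPartialTraceIdealOf I L → ∃ β ∈ colonRing K I,
      coeSubmodule K L = scale β I ∧ IsRegularIdeal L := fun L hL => by
    obtain ⟨f, rfl, hmin⟩ := isPartialTraceIdealOf_iff.mp hL
    obtain ⟨β, hβ, hf⟩ := exists_mem_colonRing_of_linearMap (K := K) hI f
    refine ⟨β, hβ, coeSubmodule_range hf, isRegularIdeal_of_length_quotient_ne_top ht ht' ?_⟩
    refine ne_top_of_le_ne_top (length_quotient_ne_top hI) ((hmin I.subtype).trans_eq ?_)
    rw [I.range_subtype]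
  obtain ⟨β, hβ, hβJ, hJreg⟩ := hreg J hJ
  have hβu := isUnit_of_coeSubmodule_eq_scale hβJ hJreg
  obtain ⟨w, hw⟩ := hβu.exists_left_inv
  ext L
  constructor
  · intro hL
    obtain ⟨δ, hδ, hδL, hLreg⟩ := hreg L hL
    have hscale : coeSubmodule K L = scale (δ * w) J :=
      coeSubmodule_eq_scale_trans hβJ hδL (by rw [mul_assoc, hw, mul_one])
    obtain ⟨_, -, hLmin⟩ := hL
    obtain ⟨_, -, hJmin⟩ := hJ
    exact ⟨δ * w, mem_colonRing_of_coeSubmodule_eq_scale hscale,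
      (length_eq_of_coeSubmodule_eq_scale_iff hJreg
        (isUnit_of_coeSubmodule_eq_scale hscale hLreg) hscale).mp (hLmin.trans hJmin.symm),
      hscale⟩
  · rintro ⟨α, hα, hval, hscale⟩
    obtain ⟨-, γ, hγ, -⟩ := normalizedVal_eq_zero_iff.mp hval
    have hlen := (length_eq_of_coeSubmodule_eq_scale_iff hJreg
      (IsUnit.of_mul_eq_one γ ((mul_comm α γ).trans hγ)) hscale).mpr hval
    have hLI : coeSubmodule K L = scale (α * β) I :=
      coeSubmodule_eq_scale_trans (coeSubmodule_eq_scale_symm hβJ hw) hscale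
        (by rw [mul_assoc, mul_comm β, hw, mul_one])
    obtain ⟨f, hf⟩ :=
      exists_coeSubmodule_eq_scale (mem_colonRing_of_coeSubmodule_eq_scale hLI)
    obtain ⟨_, -, hJmin⟩ := hJ
    exact ⟨f, IsFractionRing.coeSubmodule_injective R K (hLI.trans hf.symm), hlen.trans hJmin⟩

end Valuation
end PartialTrace

open PartialTrace in
theorem theorem1p2 {R : Type u} [CommRing R] [IsLocalRing R]
    (hCM : IsCohenMacaulayLocalRing R) (hdim : ringKrullDim R = 1)
    {K : Type v} [CommRing K] [Algebra R K] [IsFractionRing R K]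
    (I : Ideal R) (hI : IsRegularIdeal I) :
    (IsPartialTraceIdeal I ↔ IsPartialTraceIdealOf I I) ∧
    ((colonRing K I : Set K) ⊆ integralClosure R K →
      IsPartialTraceIdeal I ∧ IsPartialTraceIdealOf I I ∧ IsReduction I (traceIdeal R I)) ∧
    ((∀ Q : Ideal R, IsMaximalPrimary Q → HasPrincipalReduction Q) →
      [IsPartialTraceIdeal I,
        IsPartialTraceIdealOf I I,
        (colonRing K I : Set K) ⊆ integralClosure R K,
        IsReduction I (traceIdeal R I)].TFAE) ∧
    (∀ [IsDomain (integralClosure R K)] [IsDiscreteValuationRing (integralClosure R K)],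
      Nonempty (IsLocalRing.ResidueField R ≃+*
        IsLocalRing.ResidueField (integralClosure R K)) →
      ∀ J : Ideal R, IsPartialTraceIdealOf I J →
        {L : Ideal R | IsPartialTraceIdealOf I L} =
          {L : Ideal R | ∃ α ∈ colonRing K J, normalizedVal R α = 0 ∧
            IsLocalization.coeSubmodule K L = scale α J}) := by
  have := hCM.isNoetherianRing
  have : Ring.KrullDimLE 1 R := Ring.krullDimLE_iff.mpr hdim.le
  obtain ⟨t, ht, ht'⟩ := exists_mem_nonZeroDivisors_mem_maximalIdeal hCM hdim
  refine ⟨isPartialTraceIdeal_iff, fun h => ?_, fun hred => ?_, fun _ J hJ =>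
    setOf_isPartialTraceIdealOf_eq ht ht' hI hJ⟩
  · have h2 := isPartialTraceIdealOf_self_of_colonRing_subset ht ht' hI h
    exact ⟨isPartialTraceIdeal_iff.mpr h2, h2, isReduction_traceIdeal_of_colonRing_subset hI h⟩
  · tfae_have 1 ↔ 2 := isPartialTraceIdeal_iff
    tfae_have 2 → 3 := colonRing_subset_of_isPartialTraceIdealOf_self ht ht' hred hI
    tfae_have 3 → 2 := isPartialTraceIdealOf_self_of_colonRing_subset ht ht' hI
    tfae_have 3 → 4 := isReduction_traceIdeal_of_colonRing_subset hI
    tfae_have 4 → 3 := colonRing_subset_of_isReduction_traceIdeal hI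
    tfae_finish
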